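/- Let $d\ge 0$ and $T\ge 1$ be integers, let $A$ be a real symmetric positive definite $(d+2)\times(d+2)$ matrix, $c\in\mathbb{R}^{d+2}$, $\sigma\ge 0$ and $B>0$. Write $\|u\|_M=\sqrt{u^\top M u}$. Consider the linear stochastic bandit problem whose action set is the ellipsoid $\mathcal{X}=\{x\in\mathbb{R}^{d+2}:\|x-c\|_{A^{-1}}\le 1\}$ and whose mean-reward vector is $\theta\in\mathbb{R}^{d+2}$: in round $t=1,2,\dots$ the learner plays $x_t\in\mathcal{X}$ and observes $y_t=x_t^\top\theta+z_t$, where the noise variables $z_t$ are independent, centered and subgaussian with variance proxy $\sigma^2$. An algorithm chooses $x_t$ as a measurable function of $y_1,\dots,y_{t-1}$ and, possibly, of an internal random seed independent of the noise. Its expected regret after $T$ rounds is $$R_T(\theta)=\mathbb{E}\Big[\sum_{t=1}^T\Big(\max_{x\in\mathcal{X}}x^\top\theta-x_t^\top\theta\Big)\Big].$$ Then for every algorithm and every $\theta\in\mathbb{R}^{d+2}$ with $\|\theta\|_A=B$ there exists $\theta'\in\mathbb{R}^{d+2}$ with $$\|\theta'\|_A=B\qquad\text{and}\qquad \|\theta-\theta'\|_A^2\le\min\Big(\frac{\sigma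 d B}{\sqrt T},\,4B^2\Big)$$ such that, in the bandit problem with mean-reward vector $\theta'$ and independent Gaussian noise $z_t\sim\mathcal{N}(0,\sigma^2)$ (which is subgaussian with variance proxy $\sigma^2$), the regret of the algorithm satisfies $$R_T(\theta')\ge\min\Big(\frac{\sigma d\sqrt T}{16},\,\frac{BT}{4}\Big).$$ -/

import Mathlib

open MeasureTheory ProbabilityTheory Matrix
open scoped NNReal

namespace EllipsoidBandit

/-- The norm `‖u‖_M = √(uᵀ M u)` attached to a (positive definite) matrix `M`. -/
noncomputable def matNorm {n : ℕ} (M : Matrix (Fin n) (Fin n) ℝ) (u : Fin n → ℝ) : ℝ :=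
  Real.sqrt (u ⬝ᵥ (M *ᵥ u))

/-- The action set `{x : ‖x - c‖_{A⁻¹} ≤ 1}`. -/
def ellipsoid {n : ℕ} (A : Matrix (Fin n) (Fin n) ℝ) (c : Fin n → ℝ) : Set (Fin n → ℝ) :=
  {x | matNorm A⁻¹ (x - c) ≤ 1}

/-- The parameter set `{θ : ‖θ‖_A = B}`. -/
def parameterSphere {n : ℕ} (A : Matrix (Fin n) (Fin n) ℝ) (B : ℝ) : Set (Fin n → ℝ) :=
  {θ | matNorm A θ = B}

/-- A (possibly randomized) algorithm on the action set `ellipsoid A c`. It draws a seed `u` from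
an arbitrary probability space once and for all, and its action in round `t` (rounds are numbered
from `0`) is a jointly measurable function of the seed and of the `t` rewards seen so far.
A deterministic algorithm is one that ignores the seed. -/
structure Algorithm {n : ℕ} (A : Matrix (Fin n) (Fin n) ℝ) (c : Fin n → ℝ)
    (U : Type*) [MeasurableSpace U] where
  seedLaw : Measure U
  isProbabilityMeasure_seedLaw : IsProbabilityMeasure seedLaw
  act : (t : ℕ) → U → (Fin t → ℝ) → (Fin n → ℝ)
  measurable_act : ∀ t, Measurable fun p : U × (Fin t → ℝ) => act t p.1 p.2
  act_mem : ∀ t u y, act t u y ∈ ellipsoid A c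

/-- The marginal laws of independent, centered noise variables that are subgaussian with variance
proxy `σ²`. -/
structure SubgaussianNoise (σ : ℝ≥0) where
  law : ℕ → Measure ℝ
  isProbabilityMeasure_law : ∀ t, IsProbabilityMeasure (law t)
  centered : ∀ t, ∫ z, z ∂(law t) = 0
  subgaussian : ∀ t, HasSubgaussianMGF (fun z : ℝ => z) (σ ^ 2) (law t)

attribute [instance] Algorithm.isProbabilityMeasure_seedLaw
  SubgaussianNoise.isProbabilityMeasure_law

/-- Independent Gaussian noise `N(0, σ²)` in every round. -/
noncomputable def gaussianNoise (σ : ℝ≥0) : SubgaussianNoise σ where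
  law _ := gaussianReal 0 (σ ^ 2)
  isProbabilityMeasure_law _ := inferInstance
  centered _ := by simp
  subgaussian _ :=
    { integrable_exp_mul := fun s => integrable_exp_mul_gaussianReal s
      mgf_le := fun s => by
        have h := congrFun (mgf_fun_id_gaussianReal (μ := 0) (v := σ ^ 2)) s
        rw [h]
        simp }

/-- The rewards of the first `t` rounds, given the parameter `θ`, the seed `u` and the noise
sequence `z`: the reward of round `t` is `x_tᵀ θ + z_t`, where `x_t` is the action chosen
from the rewards of the earlier rounds. -/
def Algorithm.rewards {n : ℕ} {A : Matrix (Fin n) (Fin n) ℝ} {c : Fin n → ℝ}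
    {U : Type*} [MeasurableSpace U] (alg : Algorithm A c U) (θ : Fin n → ℝ) (u : U) (z : ℕ → ℝ) :
    (t : ℕ) → (Fin t → ℝ)
  | 0 => Fin.elim0
  | t + 1 => Fin.snoc (alg.rewards θ u z t) (alg.act t u (alg.rewards θ u z t) ⬝ᵥ θ + z t)

/-- The action `x_t` that the algorithm plays in round `t`. -/
def Algorithm.action {n : ℕ} {A : Matrix (Fin n) (Fin n) ℝ} {c : Fin n → ℝ}
    {U : Type*} [MeasurableSpace U] (alg : Algorithm A c U) (θ : Fin n → ℝ) (u : U) (z : ℕ → ℝ)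
    (t : ℕ) : Fin n → ℝ :=
  alg.act t u (alg.rewards θ u z t)

/-- The largest expected reward `max_{x ∈ ellipsoid A c} xᵀ θ` of a single action. -/
noncomputable def optimalReward {n : ℕ} (A : Matrix (Fin n) (Fin n) ℝ) (c θ : Fin n → ℝ) : ℝ :=
  sSup ((fun x : Fin n → ℝ => x ⬝ᵥ θ) '' ellipsoid A c)

/-- The expected regret `R_T(θ) = 𝔼 [∑_t (x⋆(θ)ᵀ θ - x_tᵀ θ)]` over `T` rounds. The seed and the
noise variables are independent, with the prescribed laws. -/
noncomputable def Algorithm.regret {n : ℕ} {A : Matrix (Fin n) (Fin n) ℝ} {c : Fin n → ℝ}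
    {U : Type*} [MeasurableSpace U] (alg : Algorithm A c U) {σ : ℝ≥0} (noise : SubgaussianNoise σ)
    (T : ℕ) (θ : Fin n → ℝ) : ℝ :=
  ∫ ω : U × (ℕ → ℝ), ∑ t ∈ Finset.range T,
      (optimalReward A c θ - alg.action θ ω.1 ω.2 t ⬝ᵥ θ)
    ∂(alg.seedLaw.prod (Measure.infinitePi noise.law))

end EllipsoidBandit

open EllipsoidBandit

/-! The hard instances lie on the parameter sphere near `θ`: shrink `θ` to `(1 - D) • θ` and add `B
* b * s i` along directions `v i`, with signs `s i = ±1`. The `v i` are `A`-orthonormal,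
`A`-orthogonal to `θ`, and satisfy `c ⬝ᵥ v i = 0`; such directions exist because only two of the `d
+ 2` dimensions are lost. By curvature of the ellipsoid, the regret of `x` is at least `B / 2` times
`∑ i, (x ⬝ᵥ v i - b * s i) ^ 2` (`exists_perturbation_directions`), so small regret means estimating
every sign.

Flipping the sign `s i` changes the mean reward of `x` by `2 * B * b * (x ⬝ᵥ v i)` in absolute
value. The relative entropy between the two history laws is therefore a multiple of the expected sum
of the past `(x ⬝ᵥ v i) ^ 2`, and each such square is at most `2 * b ^ 2` plus twice the squared
error. Thus information about a sign is scarce unless errors have already been made. The two-point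
bound `two_point_historyLaw` then becomes an inequality for the errors alone, closed up in
`sum_error_lower_bound` by summing over rounds and sign vectors. Summing over coordinates and
averaging over the seed and the signs gives one good sign vector
(`Algorithm.exists_regret_lower_bound`); `D` is then optimized. -/

namespace EllipsoidBandit

/-! ### Gaussian history laws, their relative entropy and a two-point bound -/

section History

/-- The law of the first `t` observations when observation `t` is Gaussian with variance `v` and
mean `p t h`, where `h` are the observations made before. -/
noncomputable def historyLaw (v : ℝ≥0) (p : (t : ℕ) → (Fin t → ℝ) → ℝ) :
    (t : ℕ) → Measure (Fin t → ℝ)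
  | 0 => Measure.dirac Fin.elim0
  | t + 1 => ((historyLaw v p t).prod (gaussianReal 0 v)).map
      fun r => (Fin.snoc r.1 (p t r.1 + r.2) : Fin (t + 1) → ℝ)

/-- The logarithm of the likelihood ratio of the history laws with means `q` and `p`. -/
noncomputable def logLikelihoodRatio (v : ℝ≥0) (p q : (t : ℕ) → (Fin t → ℝ) → ℝ) :
    (t : ℕ) → (Fin t → ℝ) → ℝ
  | 0, _ => 0
  | t + 1, h => logLikelihoodRatio v p q t (Fin.init h) +
      ((q t (Fin.init h) - p t (Fin.init h)) * (h (Fin.last t) - p t (Fin.init h)) -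
        (q t (Fin.init h) - p t (Fin.init h)) ^ 2 / 2) / v

theorem measurable_snoc {α : Type*} [MeasurableSpace α] {t : ℕ} {f : α → Fin t → ℝ} {g : α → ℝ}
    (hf : Measurable f) (hg : Measurable g) :
    Measurable fun a => (Fin.snoc (f a) (g a) : Fin (t + 1) → ℝ) := by
  refine measurable_pi_iff.2 fun i => ?_
  refine Fin.lastCases ?_ (fun j => ?_) i
  · simpa using hg
  · simpa [Function.comp_def] using (measurable_pi_apply j).comp hf

theorem measurable_init {t : ℕ} :
    Measurable fun h : Fin (t + 1) → ℝ => (Fin.init h : Fin t → ℝ) :=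
  measurable_pi_iff.2 fun i => measurable_pi_apply i.castSucc

variable {v : ℝ≥0} {p q : (t : ℕ) → (Fin t → ℝ) → ℝ}

theorem measurable_logLikelihoodRatio (hp : ∀ t, Measurable (p t)) (hq : ∀ t, Measurable (q t))
    (t : ℕ) : Measurable (logLikelihoodRatio v p q t) := by
  induction t with
  | zero => exact measurable_const
  | succ t ih =>
    have h1 := (hp t).comp measurable_init
    have h2 := (hq t).comp measurable_init
    have h3 := ih.comp measurable_init
    have h4 : Measurable fun h : Fin (t + 1) → ℝ => h (Fin.last t) := measurable_pi_apply _
    exact h3.add ((((h2.sub h1).mul (h4.sub h1)).sub (((h2.sub h1).pow_const 2).div_const 2)).div_const _)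

theorem isProbabilityMeasure_historyLaw (hp : ∀ t, Measurable (p t)) (t : ℕ) :
    IsProbabilityMeasure (historyLaw v p t) := by
  induction t with
  | zero => exact Measure.dirac.isProbabilityMeasure
  | succ t ih =>
    exact Measure.isProbabilityMeasure_map
      (measurable_snoc measurable_fst (((hp t).comp measurable_fst).add measurable_snd)).aemeasurable

theorem lintegral_historyLaw_succ (hp : ∀ t, Measurable (p t)) (t : ℕ)
    {F : (Fin (t + 1) → ℝ) → ENNReal} (hF : Measurable F) :
    ∫⁻ h, F h ∂(historyLaw v p (t + 1)) =
      ∫⁻ h, ∫⁻ y, F (Fin.snoc h y : Fin (t + 1) → ℝ) ∂(gaussianReal (p t h) v)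
        ∂(historyLaw v p t) := by
  have := isProbabilityMeasure_historyLaw (v := v) hp t
  have hm : Measurable fun r : (Fin t → ℝ) × ℝ =>
      (Fin.snoc r.1 (p t r.1 + r.2) : Fin (t + 1) → ℝ) :=
    measurable_snoc measurable_fst (((hp t).comp measurable_fst).add measurable_snd)
  rw [historyLaw, lintegral_map hF hm,
    lintegral_prod (fun r => F (Fin.snoc r.1 (p t r.1 + r.2))) (hF.comp hm).aemeasurable]
  refine lintegral_congr fun h => ?_
  have hg : gaussianReal (p t h) v = (gaussianReal 0 v).map (p t h + ·) := by
    rw [gaussianReal_map_const_add, zero_add]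
  have hFs : Measurable fun y => F (Fin.snoc h y : Fin (t + 1) → ℝ) :=
    hF.comp (measurable_snoc measurable_const measurable_id)
  rw [hg, lintegral_map hFs (measurable_const_add _)]

theorem gaussianReal_eq_withDensity (hv : v ≠ 0) (μ ν : ℝ) :
    gaussianReal ν v = (gaussianReal μ v).withDensity fun y =>
      ENNReal.ofReal (Real.exp (((ν - μ) * (y - μ) - (ν - μ) ^ 2 / 2) / v)) := by
  rw [gaussianReal_of_var_ne_zero _ hv, gaussianReal_of_var_ne_zero _ hv,
    ← withDensity_mul _ (measurable_gaussianPDF _ _) (by fun_prop)]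
  congr 1
  ext y
  have hv' : (v : ℝ) ≠ 0 := by exact_mod_cast hv
  rw [Pi.mul_apply, gaussianPDF, gaussianPDF,
    ← ENNReal.ofReal_mul (gaussianPDFReal_nonneg _ _ _), gaussianPDFReal, gaussianPDFReal,
    mul_assoc (√(2 * Real.pi * v))⁻¹, ← Real.exp_add]
  congr 3
  field_simp
  ring

theorem historyLaw_eq_withDensity (hv : v ≠ 0) (hp : ∀ t, Measurable (p t))
    (hq : ∀ t, Measurable (q t)) (t : ℕ) :
    historyLaw v q t = (historyLaw v p t).withDensity fun h =>
      ENNReal.ofReal (Real.exp (logLikelihoodRatio v p q t h)) := by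
  have hL := fun t => measurable_logLikelihoodRatio (v := v) hp hq t
  have hE : ∀ t, Measurable fun h =>
      ENNReal.ofReal (Real.exp (logLikelihoodRatio v p q t h)) :=
    fun t => (Real.measurable_exp.comp (hL t)).ennreal_ofReal
  induction t with
  | zero =>
    have : (fun h => ENNReal.ofReal (Real.exp (logLikelihoodRatio v p q 0 h))) = 1 := by
      ext h; simp [logLikelihoodRatio]
    rw [this, withDensity_one]
    rfl
  | succ t ih =>
    refine Measure.ext_of_lintegral _ fun F hF => ?_
    rw [lintegral_withDensity_eq_lintegral_mul _ (hE _) hF,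
      lintegral_historyLaw_succ hp t ((hE _).mul hF), lintegral_historyLaw_succ hq t hF, ih,
      lintegral_withDensity_eq_lintegral_mul_non_measurable _ (hE t)
        (Filter.Eventually.of_forall fun _ => ENNReal.ofReal_lt_top)]
    refine lintegral_congr fun h => ?_
    have hFs : Measurable fun y => F (Fin.snoc h y : Fin (t + 1) → ℝ) :=
      hF.comp (measurable_snoc measurable_const measurable_id)
    rw [Pi.mul_apply, gaussianReal_eq_withDensity hv (p t h) (q t h),
      lintegral_withDensity_eq_lintegral_mul _ (by fun_prop) hFs,
      ← lintegral_const_mul _ (Measurable.mul (by fun_prop) hFs)]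
    refine lintegral_congr fun y => ?_
    simp only [Pi.mul_apply, logLikelihoodRatio, Fin.init_snoc, Fin.snoc_last]
    rw [Real.exp_add, ENNReal.ofReal_mul (Real.exp_nonneg _), mul_assoc]

theorem integrable_of_abs_le {α : Type*} [MeasurableSpace α] {μ : Measure α} [IsFiniteMeasure μ]
    {f : α → ℝ} (hf : Measurable f) {C : ℝ} (hC : ∀ a, |f a| ≤ C) : Integrable f μ :=
  Integrable.of_bound hf.aestronglyMeasurable C (Filter.Eventually.of_forall hC)

/-- Under the law with means `p` the newest observation minus its mean is centered and independent
of the past, so the cross term integrates to zero and only the quadratic terms survive. This is the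
chain rule for relative entropy, with a minus sign. -/
theorem integral_logLikelihoodRatio (hp : ∀ t, Measurable (p t)) (hq : ∀ t, Measurable (q t))
    {C : ℝ} (hC : ∀ t h, |q t h - p t h| ≤ C) (t : ℕ) :
    Integrable (logLikelihoodRatio v p q t) (historyLaw v p t) ∧
      ∫ h, logLikelihoodRatio v p q t h ∂(historyLaw v p t) =
        -∑ j ∈ Finset.range t, (∫ h, (q j h - p j h) ^ 2 ∂(historyLaw v p j)) / (2 * v) := by
  induction t with
  | zero => simp [logLikelihoodRatio]
  | succ t ih =>
    have := isProbabilityMeasure_historyLaw (v := v) hp t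
    have hm : Measurable fun r : (Fin t → ℝ) × ℝ =>
        (Fin.snoc r.1 (p t r.1 + r.2) : Fin (t + 1) → ℝ) :=
      measurable_snoc measurable_fst (((hp t).comp measurable_fst).add measurable_snd)
    have hL := measurable_logLikelihoodRatio (v := v) hp hq (t + 1)
    have hδ : Measurable fun h => q t h - p t h := (hq t).sub (hp t)
    have hi1 : Integrable (fun h => q t h - p t h) (historyLaw v p t) :=
      integrable_of_abs_le hδ (hC t)
    have hi2 : Integrable (fun h => (q t h - p t h) ^ 2) (historyLaw v p t) :=
      integrable_of_abs_le (hδ.pow_const 2) (C := C ^ 2) fun h => by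
        rw [abs_pow]; exact pow_le_pow_left₀ (abs_nonneg _) (hC t h) 2
    have hid : Integrable (fun y : ℝ => y) (gaussianReal 0 v) :=
      memLp_one_iff_integrable.1 (memLp_id_gaussianReal 1)
    have e : (fun r : (Fin t → ℝ) × ℝ => logLikelihoodRatio v p q (t + 1)
        (Fin.snoc r.1 (p t r.1 + r.2) : Fin (t + 1) → ℝ)) = fun r =>
        (logLikelihoodRatio v p q t r.1 - (q t r.1 - p t r.1) ^ 2 / 2 / v) +
          ((q t r.1 - p t r.1) * r.2) / v := by
      ext r
      simp only [logLikelihoodRatio, Fin.init_snoc, Fin.snoc_last]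
      ring
    have hj1 : Integrable (fun h => logLikelihoodRatio v p q t h - (q t h - p t h) ^ 2 / 2 / v)
        (historyLaw v p t) := ih.1.sub ((hi2.div_const 2).div_const _)
    have hj2 : Integrable (fun r : (Fin t → ℝ) × ℝ => ((q t r.1 - p t r.1) * r.2) / v)
        ((historyLaw v p t).prod (gaussianReal 0 v)) := (hi1.mul_prod hid).div_const _
    constructor
    · rw [historyLaw, integrable_map_measure hL.aestronglyMeasurable hm.aemeasurable]
      show Integrable (fun r => _) _
      simp only [Function.comp_def]
      rw [e]
      exact (hj1.comp_fst _).add hj2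
    · rw [historyLaw, integral_map hm.aemeasurable hL.aestronglyMeasurable, e,
        integral_add (hj1.comp_fst _) hj2, integral_div,
        integral_prod_mul (fun h => q t h - p t h) (fun y : ℝ => y),
        integral_fun_fst (fun h => logLikelihoodRatio v p q t h - (q t h - p t h) ^ 2 / 2 / v),
        integral_sub ih.1 ((hi2.div_const 2).div_const _), ih.2, Finset.sum_range_succ,
        integral_div, integral_div]
      simp only [integral_id_gaussianReal, probReal_univ, one_smul]
      ring

/-- With `r = exp (ℓ / 2)`, the right side is minimal in `w` with value `4 * b ^ 2 * r ^ 2 / (1 + r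
^ 2)`. This exceeds `b ^ 2 * (4 * r - 1 - r ^ 2)` by `b ^ 2 * (r - 1) ^ 4 / (1 + r ^ 2)`, and `r ≥ 1
+ ℓ / 2` finishes. The left side is affine in `ℓ` and `exp ℓ`, whose means are known when `ℓ` is a
log-likelihood ratio. -/
theorem two_point_le (w b ℓ : ℝ) :
    2 * b ^ 2 * (3 / 2 + ℓ - Real.exp ℓ / 2) ≤ (w - b) ^ 2 + Real.exp ℓ * (w + b) ^ 2 := by
  set r := Real.exp (ℓ / 2) with hr
  have hr0 : 0 < r := Real.exp_pos _
  have hl : Real.exp ℓ = r ^ 2 := by rw [hr, ← Real.exp_nat_mul]; congr 1; push_cast; ring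
  have h1 : ℓ / 2 + 1 ≤ r := Real.add_one_le_exp _
  rw [hl]
  have h2 : 2 * b ^ 2 * (3 / 2 + ℓ - r ^ 2 / 2) ≤ b ^ 2 * (-1 + 4 * r - r ^ 2) := by
    nlinarith [mul_le_mul_of_nonneg_left h1 (sq_nonneg b)]
  have h3 : 0 ≤ ((w - b) ^ 2 + r ^ 2 * (w + b) ^ 2 - b ^ 2 * (-1 + 4 * r - r ^ 2)) := by
    have : (1 + r ^ 2) * ((w - b) ^ 2 + r ^ 2 * (w + b) ^ 2 - b ^ 2 * (-1 + 4 * r - r ^ 2)) =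
        ((1 + r ^ 2) * w + (r ^ 2 - 1) * b) ^ 2 + b ^ 2 * (r - 1) ^ 4 := by ring
    have h4 : 0 ≤ (1 + r ^ 2) * ((w - b) ^ 2 + r ^ 2 * (w + b) ^ 2 -
        b ^ 2 * (-1 + 4 * r - r ^ 2)) := by rw [this]; positivity
    exact nonneg_of_mul_nonneg_right h4 (by positivity)
  linarith

/-- Two-point lower bound: an estimator `w` cannot be close to `b` under one history law and close
to `-b` under the other, unless the two laws are far apart in relative entropy. -/
theorem two_point_historyLaw (hv : v ≠ 0) (hp : ∀ t, Measurable (p t))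
    (hq : ∀ t, Measurable (q t)) {C : ℝ} (hC : ∀ t h, |q t h - p t h| ≤ C) (t : ℕ)
    {w : (Fin t → ℝ) → ℝ} (hw : Measurable w) {K : ℝ} (hK : ∀ h, |w h| ≤ K) (b : ℝ) :
    2 * b ^ 2 * (1 - ∑ j ∈ Finset.range t,
        (∫ h, (q j h - p j h) ^ 2 ∂(historyLaw v p j)) / (2 * v)) ≤
      ∫ h, (w h - b) ^ 2 ∂(historyLaw v p t) + ∫ h, (w h + b) ^ 2 ∂(historyLaw v q t) := by
  have hP := isProbabilityMeasure_historyLaw (v := v) hp t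
  have hQ := isProbabilityMeasure_historyLaw (v := v) hq t
  have hL := measurable_logLikelihoodRatio (v := v) hp hq t
  have hE : Measurable fun h => Real.exp (logLikelihoodRatio v p q t h) :=
    Real.measurable_exp.comp hL
  have hd := historyLaw_eq_withDensity hv hp hq t
  obtain ⟨hi, he⟩ := integral_logLikelihoodRatio (v := v) hp hq hC t
  have key : ∀ g : (Fin t → ℝ) → ℝ, Integrable g (historyLaw v q t) →
      Integrable (fun h => Real.exp (logLikelihoodRatio v p q t h) * g h) (historyLaw v p t) ∧
      ∫ h, g h ∂(historyLaw v q t) =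
        ∫ h, Real.exp (logLikelihoodRatio v p q t h) * g h ∂(historyLaw v p t) := by
    intro g hg
    rw [hd] at hg ⊢
    have hlt : ∀ᵐ h ∂(historyLaw v p t),
        ENNReal.ofReal (Real.exp (logLikelihoodRatio v p q t h)) < ⊤ :=
      Filter.Eventually.of_forall fun _ => ENNReal.ofReal_lt_top
    rw [integrable_withDensity_iff_integrable_smul' hE.ennreal_ofReal hlt] at hg
    rw [integral_withDensity_eq_integral_toReal_smul hE.ennreal_ofReal hlt]
    simp only [ENNReal.toReal_ofReal (Real.exp_nonneg _), smul_eq_mul] at hg ⊢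
    exact ⟨hg, trivial⟩
  have hbd : ∀ (b : ℝ) h, |(w h + b) ^ 2| ≤ (K + |b|) ^ 2 := fun b h => by
    rw [abs_pow]
    exact pow_le_pow_left₀ (abs_nonneg _) ((abs_add_le _ _).trans (by linarith [hK h])) 2
  have hi1 : Integrable (fun h => (w h - b) ^ 2) (historyLaw v p t) := by
    simp only [sub_eq_add_neg]
    exact integrable_of_abs_le ((hw.add_const _).pow_const 2) (hbd (-b))
  have hi2 : Integrable (fun h => (w h + b) ^ 2) (historyLaw v q t) :=
    integrable_of_abs_le ((hw.add_const _).pow_const 2) (hbd b)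
  obtain ⟨h1, h2⟩ := key _ hi2
  -- The likelihood ratio has mean `1`; this turns the constant `3 / 2 - 1 / 2` into the `1` of the
  -- statement.
  obtain ⟨h3, h4⟩ := key (fun _ => 1) (integrable_const _)
  simp only [mul_one, integral_const, probReal_univ, one_smul] at h3 h4
  rw [h2, ← integral_add hi1 h1]
  have h5 : Integrable (fun h => 3 / 2 + logLikelihoodRatio v p q t h) (historyLaw v p t) :=
    (integrable_const _).add hi
  have hmono := integral_mono ((h5.sub (h3.div_const 2)).const_mul (2 * b ^ 2)) (hi1.add h1)
    fun h => two_point_le (w h) b (logLikelihoodRatio v p q t h)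
  refine le_trans (le_of_eq ?_) hmono
  simp only [Pi.sub_apply]
  rw [integral_const_mul, integral_sub h5 (h3.div_const 2), integral_add (integrable_const _) hi,
    integral_div _ (fun h => Real.exp (logLikelihoodRatio v p q t h)), ← h4, he]
  simp only [integral_const, probReal_univ, one_smul]
  ring

end History

/-! ### Geometry of the ellipsoid and the perturbation directions -/

section Geometry

open scoped InnerProductSpace MatrixOrder in
/-- A positive definite matrix is the Gram form of a linear map to Euclidean space. -/
theorem exists_euclidean_isometry {n : ℕ} {A : Matrix (Fin n) (Fin n) ℝ} (hA : A.PosDef) :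
    ∃ e : (Fin n → ℝ) ≃ₗ[ℝ] EuclideanSpace ℝ (Fin n), ∀ u w, ⟪e u, e w⟫_ℝ = u ⬝ᵥ (A *ᵥ w) := by
  obtain ⟨S, hS⟩ := CStarAlgebra.nonneg_iff_eq_star_mul_self.mp hA.posSemidef.nonneg
  let f : (Fin n → ℝ) →ₗ[ℝ] EuclideanSpace ℝ (Fin n) :=
    (WithLp.linearEquiv 2 ℝ (Fin n → ℝ)).symm.toLinearMap ∘ₗ S.mulVecLin
  have hf : ∀ u w, ⟪f u, f w⟫_ℝ = u ⬝ᵥ (A *ᵥ w) := by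
    intro u w
    have : ⟪f u, f w⟫_ℝ = (S *ᵥ w) ⬝ᵥ (S *ᵥ u) := by
      simp [f, EuclideanSpace.inner_eq_star_dotProduct]
    rw [this, hS, ← mulVec_mulVec, dotProduct_mulVec u, star_eq_conjTranspose,
      conjTranspose_eq_transpose_of_trivial, vecMul_transpose, dotProduct_comm]
  have hinj : Function.Injective f := by
    rw [← LinearMap.ker_eq_bot, LinearMap.ker_eq_bot']
    intro u hu
    by_contra hne
    have h1 := hA.dotProduct_mulVec_pos hne
    rw [star_trivial, ← hf, hu, inner_zero_left] at h1
    exact lt_irrefl _ h1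
  exact ⟨LinearEquiv.ofInjectiveOfFinrankEq f hinj (by simp), hf⟩

variable {n : ℕ} {A : Matrix (Fin n) (Fin n) ℝ}

open scoped InnerProductSpace in
theorem matNorm_eq_norm {e : (Fin n → ℝ) ≃ₗ[ℝ] EuclideanSpace ℝ (Fin n)}
    (he : ∀ u w, ⟪e u, e w⟫_ℝ = u ⬝ᵥ (A *ᵥ w)) (u : Fin n → ℝ) : matNorm A u = ‖e u‖ := by
  rw [matNorm, ← he, real_inner_self_eq_norm_sq, Real.sqrt_sq (norm_nonneg _)]

open scoped InnerProductSpace in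
theorem inner_inv_mulVec (hA : A.PosDef) {e : (Fin n → ℝ) ≃ₗ[ℝ] EuclideanSpace ℝ (Fin n)}
    (he : ∀ u w, ⟪e u, e w⟫_ℝ = u ⬝ᵥ (A *ᵥ w)) (z u : Fin n → ℝ) :
    ⟪e (A⁻¹ *ᵥ z), e u⟫_ℝ = z ⬝ᵥ u := by
  have hu : IsUnit A.det := (isUnit_iff_isUnit_det A).1 hA.isUnit
  rw [real_inner_comm, he, mulVec_mulVec, mul_nonsing_inv _ hu, one_mulVec, dotProduct_comm]

open scoped InnerProductSpace in
theorem matNorm_inv_eq_norm (hA : A.PosDef) {e : (Fin n → ℝ) ≃ₗ[ℝ] EuclideanSpace ℝ (Fin n)}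
    (he : ∀ u w, ⟪e u, e w⟫_ℝ = u ⬝ᵥ (A *ᵥ w)) (z : Fin n → ℝ) :
    matNorm A⁻¹ z = ‖e (A⁻¹ *ᵥ z)‖ := by
  rw [matNorm, ← inner_inv_mulVec hA he, real_inner_self_eq_norm_sq, Real.sqrt_sq (norm_nonneg _)]

theorem abs_dotProduct_sub_le (hA : A.PosDef) {c x : Fin n → ℝ} (hx : x ∈ ellipsoid A c)
    (u : Fin n → ℝ) : |(x - c) ⬝ᵥ u| ≤ matNorm A u := by
  obtain ⟨e, he⟩ := exists_euclidean_isometry hA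
  rw [← inner_inv_mulVec hA he, matNorm_eq_norm he]
  refine (abs_real_inner_le_norm _ _).trans ?_
  have hx' : ‖e (A⁻¹ *ᵥ (x - c))‖ ≤ 1 := by rw [← matNorm_inv_eq_norm hA he]; exact hx
  nlinarith [norm_nonneg (e u)]

theorem abs_dotProduct_le (hA : A.PosDef) {c x : Fin n → ℝ} (hx : x ∈ ellipsoid A c)
    (u : Fin n → ℝ) : |x ⬝ᵥ u| ≤ matNorm A u + |c ⬝ᵥ u| := by
  have h : x ⬝ᵥ u = (x - c) ⬝ᵥ u + c ⬝ᵥ u := by rw [← add_dotProduct, sub_add_cancel]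
  rw [h]
  exact (abs_add_le _ _).trans (by linarith [abs_dotProduct_sub_le hA hx u])

theorem le_optimalReward (hA : A.PosDef) {c x : Fin n → ℝ} (hx : x ∈ ellipsoid A c)
    (u : Fin n → ℝ) : x ⬝ᵥ u ≤ optimalReward A c u :=
  le_csSup ⟨matNorm A u + |c ⬝ᵥ u|, by
    rintro _ ⟨y, hy, rfl⟩
    exact (le_abs_self _).trans (abs_dotProduct_le hA hy u)⟩ ⟨x, hx, rfl⟩

/-- The boundary point `c + (matNorm A u)⁻¹ • (A *ᵥ u)` attains the value on the left. -/
theorem add_matNorm_le_optimalReward (hA : A.PosDef) (c u : Fin n → ℝ) (hu : 0 < matNorm A u) :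
    c ⬝ᵥ u + matNorm A u ≤ optimalReward A c u := by
  obtain ⟨e, he⟩ := exists_euclidean_isometry hA
  have hdet : IsUnit A.det := (isUnit_iff_isUnit_det A).1 hA.isUnit
  have hcancel : A⁻¹ *ᵥ ((matNorm A u)⁻¹ • (A *ᵥ u)) = (matNorm A u)⁻¹ • u := by
    rw [mulVec_smul, mulVec_mulVec, nonsing_inv_mul _ hdet, one_mulVec]
  have hx : c + (matNorm A u)⁻¹ • (A *ᵥ u) ∈ ellipsoid A c := by
    show matNorm A⁻¹ _ ≤ 1
    rw [add_sub_cancel_left, matNorm_inv_eq_norm hA he, hcancel, map_smul, norm_smul,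
      ← matNorm_eq_norm he, Real.norm_eq_abs, abs_of_pos (inv_pos.2 hu), inv_mul_cancel₀ hu.ne']
  have h := le_optimalReward hA hx u
  have h2 : (A *ᵥ u) ⬝ᵥ u = matNorm A u ^ 2 := by
    rw [dotProduct_comm, ← he, real_inner_self_eq_norm_sq, matNorm_eq_norm he]
  rw [add_dotProduct, smul_dotProduct, h2, smul_eq_mul, pow_two, inv_mul_cancel_left₀ hu.ne'] at h
  exact h

open scoped InnerProductSpace in
theorem exists_orthonormal_perp {d : ℕ} (f g : EuclideanSpace ℝ (Fin (d + 2))) :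
    ∃ w : Fin d → EuclideanSpace ℝ (Fin (d + 2)), Orthonormal ℝ w ∧
      ∀ i, ⟪f, w i⟫_ℝ = 0 ∧ ⟪g, w i⟫_ℝ = 0 := by
  classical
  let K : Submodule ℝ (EuclideanSpace ℝ (Fin (d + 2))) :=
    Submodule.span ℝ (({f, g} : Finset (EuclideanSpace ℝ (Fin (d + 2)))) : Set _)
  have h1 := K.finrank_add_finrank_orthogonal
  have h2 : Module.finrank ℝ K ≤ 2 := (finrank_span_finset_le_card _).trans Finset.card_le_two
  rw [finrank_euclideanSpace_fin] at h1
  have h3 : d ≤ Module.finrank ℝ Kᗮ := by omega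
  let b := stdOrthonormalBasis ℝ Kᗮ
  refine ⟨fun i => (b (Fin.castLE h3 i) : EuclideanSpace ℝ (Fin (d + 2))), ?_, fun i => ?_⟩
  · exact (b.orthonormal.comp_linearIsometry Kᗮ.subtypeₗᵢ).comp _ (Fin.castLE_injective h3)
  · have hm : ∀ x ∈ K, ⟪x, (b (Fin.castLE h3 i) : EuclideanSpace ℝ (Fin (d + 2)))⟫_ℝ = 0 :=
      fun x hx => (Submodule.mem_orthogonal K _).1 (b (Fin.castLE h3 i)).2 x hx
    exact ⟨hm f (Submodule.subset_span (by simp)), hm g (Submodule.subset_span (by simp))⟩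

open scoped InnerProductSpace in
/-- Perturbation directions for a parameter: they are invisible at the center of the ellipsoid, and
the regret of an action at a perturbed parameter controls its distance to the perturbation. -/
theorem exists_perturbation_directions {d : ℕ} {A : Matrix (Fin (d + 2)) (Fin (d + 2)) ℝ}
    (hA : A.PosDef) (c : Fin (d + 2) → ℝ) {B : ℝ} (hB : 0 < B) {θ : Fin (d + 2) → ℝ}
    (hθ : matNorm A θ = B) :
    ∃ v : Fin d → Fin (d + 2) → ℝ, ∀ (a : ℝ) (k : Fin d → ℝ), a ^ 2 + ∑ i, k i ^ 2 = 1 →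
      matNorm A (a • θ + ∑ i, (B * k i) • v i) = B ∧
      matNorm A (θ - (a • θ + ∑ i, (B * k i) • v i)) ^ 2 = 2 * B ^ 2 * (1 - a) ∧
      ∀ x ∈ ellipsoid A c, B / 2 * ∑ i, (x ⬝ᵥ v i - k i) ^ 2 ≤
        optimalReward A c (a • θ + ∑ i, (B * k i) • v i) -
          x ⬝ᵥ (a • θ + ∑ i, (B * k i) • v i) := by
  obtain ⟨e, he⟩ := exists_euclidean_isometry hA
  obtain ⟨w, hw, hperp⟩ := exists_orthonormal_perp (e θ) (e (A⁻¹ *ᵥ c))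
  refine ⟨fun i => e.symm (w i), fun a k hk => ?_⟩
  set ϑ : Fin (d + 2) → ℝ := a • θ + ∑ i, (B * k i) • e.symm (w i) with hϑ
  have heθ : ‖e θ‖ = B := by rw [← matNorm_eq_norm he, hθ]
  have hev : e ϑ = a • e θ + B • ∑ i, k i • w i := by
    simp [hϑ, map_add, map_sum, Finset.smul_sum, smul_smul]
  have hsum : ‖∑ i, k i • w i‖ ^ 2 = ∑ i, k i ^ 2 := by
    rw [← real_inner_self_eq_norm_sq, hw.inner_sum]
    simp [pow_two]
  have hθs : ⟪e θ, ∑ i, k i • w i⟫_ℝ = 0 := by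
    rw [inner_sum]
    exact Finset.sum_eq_zero fun i _ => by rw [inner_smul_right, (hperp i).1, mul_zero]
  have hθϑ : ⟪e θ, e ϑ⟫_ℝ = a * B ^ 2 := by
    rw [hev, inner_add_right, inner_smul_right, inner_smul_right, hθs, real_inner_self_eq_norm_sq,
      heθ]
    ring
  have hsq : ‖e ϑ‖ ^ 2 = B ^ 2 := by
    rw [hev, norm_add_sq_real, inner_smul_left, inner_smul_right, hθs, norm_smul, norm_smul,
      mul_pow, mul_pow, hsum, heθ, Real.norm_eq_abs, Real.norm_eq_abs, sq_abs, sq_abs]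
    linear_combination B ^ 2 * hk
  have hnorm : ‖e ϑ‖ = B := by
    rw [← abs_of_nonneg (norm_nonneg (e ϑ)), ← abs_of_pos hB]
    exact (sq_eq_sq_iff_abs_eq_abs _ _).1 hsq
  have hmat : matNorm A ϑ = B := by rw [matNorm_eq_norm he, hnorm]
  refine ⟨hmat, ?_, fun x hx => ?_⟩
  · rw [matNorm_eq_norm he, map_sub, norm_sub_sq_real, hθϑ, hsq, heθ]
    ring
  · have hopt := add_matNorm_le_optimalReward hA c ϑ (by rw [hmat]; exact hB)
    rw [hmat] at hopt
    set p := e (A⁻¹ *ᵥ (x - c)) with hp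
    have hp1 : ‖p‖ ≤ 1 := by rw [hp, ← matNorm_inv_eq_norm hA he]; exact hx
    have hpϑ : ⟪p, e ϑ⟫_ℝ = x ⬝ᵥ ϑ - c ⬝ᵥ ϑ := by
      rw [hp, inner_inv_mulVec hA he, sub_dotProduct]
    have hpw : ∀ i, ⟪w i, p - B⁻¹ • e ϑ⟫_ℝ = x ⬝ᵥ e.symm (w i) - k i := by
      intro i
      have h1 : ⟪w i, p⟫_ℝ = x ⬝ᵥ e.symm (w i) := by
        have h2 := inner_inv_mulVec hA he (x - c) (e.symm (w i))
        have h3 := inner_inv_mulVec hA he c (e.symm (w i))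
        rw [e.apply_symm_apply] at h2 h3
        rw [real_inner_comm, hp, h2, sub_dotProduct, ← h3, (hperp i).2, sub_zero]
      have h4 : ⟪w i, e ϑ⟫_ℝ = B * k i := by
        rw [hev, inner_add_right, inner_smul_right, inner_smul_right, real_inner_comm,
          (hperp i).1, hw.inner_right_fintype]
        ring
      rw [inner_sub_right, inner_smul_right, h1, h4, inv_mul_cancel_left₀ hB.ne']
    -- Bessel's inequality for the difference between the normalized action and the unit vector
    -- along `e ϑ`. Since `‖p‖ ≤ 1`, its squared norm is at most `2 - 2 * ⟪p, B⁻¹ • e ϑ⟫`, which is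
    -- `2 / B` times the regret bound.
    have hb := hw.sum_inner_products_le (p - B⁻¹ • e ϑ) (s := Finset.univ)
    simp only [hpw, Real.norm_eq_abs, sq_abs] at hb
    rw [norm_sub_sq_real, inner_smul_right, norm_smul, hnorm, Real.norm_eq_abs,
      abs_of_pos (inv_pos.2 hB), inv_mul_cancel₀ hB.ne', hpϑ] at hb
    have hp2 : ‖p‖ ^ 2 ≤ 1 := pow_le_one₀ (norm_nonneg _) hp1
    have hb2 : B / 2 * ∑ i, (x ⬝ᵥ e.symm (w i) - k i) ^ 2 ≤
        B / 2 * (2 - 2 * (B⁻¹ * (x ⬝ᵥ ϑ - c ⬝ᵥ ϑ))) :=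
      mul_le_mul_of_nonneg_left (by linarith) (by positivity)
    have hb3 : B / 2 * (2 - 2 * (B⁻¹ * (x ⬝ᵥ ϑ - c ⬝ᵥ ϑ))) = B - (x ⬝ᵥ ϑ - c ⬝ᵥ ϑ) := by
      field_simp
    linarith

end Geometry

/-! ### From the noise sequence to history laws -/

section Law

variable {n : ℕ} {A : Matrix (Fin n) (Fin n) ℝ} {c : Fin n → ℝ} {U : Type*} [MeasurableSpace U]

/-- The mean reward of the action chosen in round `t`, as a function of the history. -/
def Algorithm.meanReward (alg : Algorithm A c U) (θ : Fin n → ℝ) (u : U) (t : ℕ)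
    (h : Fin t → ℝ) : ℝ :=
  alg.act t u h ⬝ᵥ θ

theorem measurable_dotProduct_const {α : Type*} [MeasurableSpace α] {f : α → Fin n → ℝ}
    (hf : Measurable f) (θ : Fin n → ℝ) : Measurable fun a => f a ⬝ᵥ θ :=
  Finset.measurable_fun_sum _ fun i _ => ((measurable_pi_apply i).comp hf).mul_const _

variable (alg : Algorithm A c U) (θ : Fin n → ℝ)

theorem Algorithm.measurable_meanReward (u : U) (t : ℕ) : Measurable (alg.meanReward θ u t) :=
  measurable_dotProduct_const ((alg.measurable_act t).comp measurable_prodMk_left) θ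

theorem Algorithm.measurable_rewards (t : ℕ) :
    Measurable fun ω : U × (ℕ → ℝ) => alg.rewards θ ω.1 ω.2 t := by
  induction t with
  | zero => exact measurable_const
  | succ t ih =>
    refine measurable_snoc ih ?_
    exact (measurable_dotProduct_const
      ((alg.measurable_act t).comp (measurable_fst.prodMk ih)) θ).add
        ((measurable_pi_apply t).comp measurable_snd)

theorem Algorithm.measurable_action (t : ℕ) :
    Measurable fun ω : U × (ℕ → ℝ) => alg.action θ ω.1 ω.2 t :=
  (alg.measurable_act t).comp (measurable_fst.prodMk (alg.measurable_rewards θ t))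

theorem Algorithm.rewards_congr (u : U) {z z' : ℕ → ℝ} {t : ℕ} (h : ∀ j < t, z j = z' j) :
    alg.rewards θ u z t = alg.rewards θ u z' t := by
  induction t with
  | zero => rfl
  | succ t ih =>
    rw [Algorithm.rewards, Algorithm.rewards, ih fun j hj => h j (hj.trans t.lt_succ_self),
      h t t.lt_succ_self]

/-- The first `t` rewards depend only on the noise of rounds before `t`, which is independent of `z
t`. -/
theorem Algorithm.indepFun_rewards {ν : ℕ → Measure ℝ} [∀ t, IsProbabilityMeasure (ν t)] (u : U)
    (t : ℕ) : IndepFun (fun z => alg.rewards θ u z t) (fun z => z t) (Measure.infinitePi ν) := by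
  classical
  have h := (iIndepFun_infinitePi (P := ν) (X := fun _ x => x)
    fun _ => measurable_id).indepFun_finset (Finset.range t) {t} (by simp)
      fun i => measurable_pi_apply i
  -- Extending the first `t` noise values by `0` is harmless: the later values do not enter the
  -- first `t` rewards.
  have hext : Measurable fun (y : Finset.range t → ℝ) (j : ℕ) =>
      if hj : j ∈ Finset.range t then y ⟨j, hj⟩ else 0 := by
    refine measurable_pi_lambda _ fun j => ?_
    by_cases hj : j ∈ Finset.range t
    · have : (fun y : Finset.range t → ℝ => if hj : j ∈ Finset.range t then y ⟨j, hj⟩ else 0) =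
          fun y => y ⟨j, hj⟩ := funext fun y => dif_pos hj
      exact this ▸ measurable_pi_apply _
    · have : (fun y : Finset.range t → ℝ => if hj : j ∈ Finset.range t then y ⟨j, hj⟩ else 0) =
          fun _ => 0 := funext fun y => dif_neg hj
      exact this ▸ measurable_const
  have hmeas : Measurable fun y : Finset.range t → ℝ =>
      alg.rewards θ u (fun j => if hj : j ∈ Finset.range t then y ⟨j, hj⟩ else 0) t :=
    ((alg.measurable_rewards θ t).comp measurable_prodMk_left).comp hext
  have h2 := h.comp hmeas
    (measurable_pi_apply (⟨t, Finset.mem_singleton_self t⟩ : ({t} : Finset ℕ)))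
  refine (h2.congr ?_ ?_)
  · refine Filter.Eventually.of_forall fun z => ?_
    refine alg.rewards_congr θ u fun j hj => ?_
    simp [hj]
  · exact Filter.Eventually.of_forall fun z => rfl

theorem Algorithm.map_rewards (v : ℝ≥0) (u : U) (t : ℕ) :
    (Measure.infinitePi fun _ : ℕ => gaussianReal 0 v).map (fun z => alg.rewards θ u z t) =
      historyLaw v (alg.meanReward θ u) t := by
  have hr : ∀ t, Measurable fun z => alg.rewards θ u z t :=
    fun t => (alg.measurable_rewards θ t).comp measurable_prodMk_left
  induction t with
  | zero =>
    rw [historyLaw]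
    show Measure.map (fun _ => Fin.elim0) _ = _
    rw [Measure.map_const, measure_univ, one_smul]
  | succ t ih =>
    have hind := (alg.indepFun_rewards (ν := fun _ => gaussianReal 0 v) θ u t)
    rw [indepFun_iff_map_prod_eq_prod_map_map (hr t).aemeasurable
      (measurable_pi_apply t).aemeasurable, ih,
      Measure.infinitePi_map_eval (fun _ : ℕ => gaussianReal 0 v) t] at hind
    rw [historyLaw, ← hind, Measure.map_map _ ((hr t).prodMk (measurable_pi_apply t))]
    · rfl
    · exact measurable_snoc measurable_fst
        (((alg.measurable_meanReward θ u t).comp measurable_fst).add measurable_snd)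

theorem Algorithm.integrable_regret (hA : A.PosDef) (μ : Measure (U × (ℕ → ℝ)))
    [IsFiniteMeasure μ] (t : ℕ) :
    Integrable (fun ω : U × (ℕ → ℝ) => optimalReward A c θ - alg.action θ ω.1 ω.2 t ⬝ᵥ θ) μ :=
  (integrable_const _).sub (integrable_of_abs_le
    (measurable_dotProduct_const (alg.measurable_action θ t) θ)
    fun _ => abs_dotProduct_le hA (alg.act_mem _ _ _) θ)

/-- By Fubini the seed can be frozen, which reduces a randomized algorithm to deterministic ones. -/
theorem Algorithm.regret_eq (hA : A.PosDef) (σ : ℝ≥0) (T : ℕ) :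
    Integrable (fun u => ∑ t ∈ Finset.range T, ∫ h, (optimalReward A c θ - alg.meanReward θ u t h)
        ∂(historyLaw (σ ^ 2) (alg.meanReward θ u) t)) alg.seedLaw ∧
    alg.regret (gaussianNoise σ) T θ = ∫ u, ∑ t ∈ Finset.range T,
      ∫ h, (optimalReward A c θ - alg.meanReward θ u t h)
        ∂(historyLaw (σ ^ 2) (alg.meanReward θ u) t) ∂alg.seedLaw := by
  have hint := fun t => alg.integrable_regret θ hA
    (alg.seedLaw.prod (Measure.infinitePi (gaussianNoise σ).law)) t
  have hin : ∀ u t, ∫ h, (optimalReward A c θ - alg.meanReward θ u t h)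
      ∂(historyLaw (σ ^ 2) (alg.meanReward θ u) t) =
      ∫ z, (optimalReward A c θ - alg.action θ u z t ⬝ᵥ θ)
        ∂(Measure.infinitePi (gaussianNoise σ).law) := by
    intro u t
    have hr : Measurable fun z => alg.rewards θ u z t :=
      (alg.measurable_rewards θ t).comp measurable_prodMk_left
    have hm : Measurable fun h => optimalReward A c θ - alg.meanReward θ u t h :=
      measurable_const.sub (alg.measurable_meanReward θ u t)
    rw [← alg.map_rewards θ, integral_map hr.aemeasurable hm.aestronglyMeasurable]
    rfl
  simp only [hin]
  constructor
  · exact integrable_finsetSum _ fun t _ => (hint t).integral_prod_left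
  · rw [Algorithm.regret, integral_finsetSum _ fun t _ => hint t,
      integral_finsetSum _ fun t _ => (hint t).integral_prod_left]
    exact Finset.sum_congr rfl fun t _ => integral_prod _ (hint t)

theorem Algorithm.regret_nonneg (hA : A.PosDef) {σ : ℝ≥0} (noise : SubgaussianNoise σ) (T : ℕ) :
    0 ≤ alg.regret noise T θ :=
  integral_nonneg fun _ => Finset.sum_nonneg fun _ _ =>
    sub_nonneg.2 (le_optimalReward hA (alg.act_mem _ _ _) θ)

end Law

/-! ### Sign flips, the self-bounding error inequality and averaging -/

section LowerBound

/-- The sign change of one coordinate, as a permutation of the sign vectors. -/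
def flipSign {d : ℕ} (i : Fin d) : Equiv.Perm (Fin d → ℤˣ) :=
  Equiv.mulRight (Pi.mulSingle i (-1))

theorem flipSign_same {d : ℕ} (i : Fin d) (s : Fin d → ℤˣ) : flipSign i s i = -s i := by
  simp [flipSign]

theorem flipSign_of_ne {d : ℕ} {i j : Fin d} (h : j ≠ i) (s : Fin d → ℤˣ) :
    flipSign i s j = s j := by
  simp [flipSign, Pi.mulSingle_eq_of_ne h]

theorem sq_units_cast (s : ℤˣ) : ((s : ℤ) : ℝ) ^ 2 = 1 := by
  rcases Int.units_eq_one_or s with h | h <;> simp [h]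

/-- The parameter obtained from a multiple of `θ` by moving along `±v i` for every `i`. -/
def perturbation {n d : ℕ} (θ : Fin n → ℝ) (v : Fin d → Fin n → ℝ) (B a b : ℝ)
    (s : Fin d → ℤˣ) : Fin n → ℝ :=
  a • θ + ∑ i, (B * (b * ((s i : ℤ) : ℝ))) • v i

theorem dotProduct_perturbation_flip {n d : ℕ} (θ : Fin n → ℝ) (v : Fin d → Fin n → ℝ)
    (B a b : ℝ) (s : Fin d → ℤˣ) (i : Fin d) (x : Fin n → ℝ) :
    x ⬝ᵥ perturbation θ v B a b (flipSign i s) - x ⬝ᵥ perturbation θ v B a b s =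
      -(2 * B * b * ((s i : ℤ) : ℝ) * (x ⬝ᵥ v i)) := by
  simp only [perturbation, dotProduct_add, dotProduct_sum, dotProduct_smul, smul_eq_mul]
  rw [add_sub_add_left_eq_sub, ← Finset.sum_sub_distrib, Finset.sum_eq_single i]
  · rw [flipSign_same]
    push_cast
    ring
  · intro j _ hj
    rw [flipSign_of_ne hj, sub_self]
  · simp

/-- If for every pair of points exchanged by a permutation the total errors cannot both be small
unless the errors of the past were large, then the total error is large. -/
theorem sum_error_lower_bound {S : Type*} [Fintype S] (e : Equiv.Perm S) (M : S → ℕ → ℝ)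
    (hM : ∀ s t, 0 ≤ M s t) {β γ : ℝ} (hβ : 0 ≤ β) (hγ : 0 ≤ γ) (T : ℕ)
    (h : ∀ s, ∀ t < T, 2 * β * (1 - γ * ∑ j ∈ Finset.range t, (2 * β + 2 * M s j)) ≤
      M s t + M (e s) t) :
    Fintype.card S * T * β * (1 - 2 * γ * T * β) ≤
      (1 + 2 * γ * T * β) * ∑ s, ∑ t ∈ Finset.range T, M s t := by
  have h1 : ∀ s, 2 * β * (T - γ * T * (2 * β * T + 2 * ∑ t ∈ Finset.range T, M s t)) ≤
      ∑ t ∈ Finset.range T, M s t + ∑ t ∈ Finset.range T, M (e s) t := by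
    intro s
    rw [← Finset.sum_add_distrib]
    -- Enlarging the past of round `t` to all `T` rounds only weakens the bound, and makes it
    -- independent of `t`.
    have h2 : ∀ t ∈ Finset.range T,
        2 * β * (1 - γ * (2 * β * T + 2 * ∑ j ∈ Finset.range T, M s j)) ≤
          M s t + M (e s) t := by
      intro t ht
      refine le_trans ?_ (h s t (Finset.mem_range.1 ht))
      have h3 : ∑ j ∈ Finset.range t, (2 * β + 2 * M s j) ≤
          2 * β * T + 2 * ∑ j ∈ Finset.range T, M s j := by
        calc ∑ j ∈ Finset.range t, (2 * β + 2 * M s j)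
            ≤ ∑ j ∈ Finset.range T, (2 * β + 2 * M s j) :=
              Finset.sum_le_sum_of_subset_of_nonneg
                (Finset.range_subset_range.2 (Finset.mem_range.1 ht).le)
                fun j _ _ => by linarith [hM s j]
          _ = _ := by
              rw [Finset.sum_add_distrib, ← Finset.mul_sum (f := M s), Finset.sum_const,
                Finset.card_range, nsmul_eq_mul]
              ring
      have h4 := mul_le_mul_of_nonneg_left h3 hγ
      exact mul_le_mul_of_nonneg_left (by linarith) (by linarith)
    have h5 := Finset.sum_le_sum h2
    rw [Finset.sum_const, Finset.card_range, nsmul_eq_mul] at h5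
    refine le_trans (le_of_eq ?_) h5
    ring
  have h6 := Finset.sum_le_sum fun s (_ : s ∈ Finset.univ) => h1 s
  -- Since `e` permutes `S`, both error sums on the right have the same total.
  rw [Finset.sum_add_distrib, Equiv.sum_comp e fun s => ∑ t ∈ Finset.range T, M s t, ← Finset.mul_sum,
    Finset.sum_sub_distrib, ← Finset.mul_sum, Finset.sum_add_distrib, ← Finset.mul_sum] at h6
  simp only [Finset.sum_const, Finset.card_univ, nsmul_eq_mul] at h6
  rw [← Finset.mul_sum] at h6
  linarith

variable {d : ℕ} {A : Matrix (Fin (d + 2)) (Fin (d + 2)) ℝ} {c : Fin (d + 2) → ℝ}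
  {U : Type*} [MeasurableSpace U]

/-- Here `sum_error_lower_bound` is used with `β = b ^ 2` and `γ = 2 * B ^ 2 * b ^ 2 / σ ^ 2`. A
round contributes `γ` times the mean of `(x ⬝ᵥ v i) ^ 2` to the relative entropy between the laws
for `s` and for `s` with sign `i` flipped. -/
theorem Algorithm.sum_perturbation_error (alg : Algorithm A c U) (hA : A.PosDef) {σ : ℝ≥0}
    (hσ : σ ≠ 0) (θ : Fin (d + 2) → ℝ) (v : Fin d → Fin (d + 2) → ℝ) (B a b : ℝ) (u : U) (T : ℕ)
    (i : Fin d) :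
    Fintype.card (Fin d → ℤˣ) * T * b ^ 2 * (1 - 2 * (2 * B ^ 2 * b ^ 2 / σ ^ 2) * T * b ^ 2) ≤
      (1 + 2 * (2 * B ^ 2 * b ^ 2 / σ ^ 2) * T * b ^ 2) *
        ∑ s : Fin d → ℤˣ, ∑ t ∈ Finset.range T,
          ∫ h, (alg.act t u h ⬝ᵥ v i - b * ((s i : ℤ) : ℝ)) ^ 2
            ∂(historyLaw (σ ^ 2) (alg.meanReward (perturbation θ v B a b s) u) t) := by
  set p : (Fin d → ℤˣ) → (t : ℕ) → (Fin t → ℝ) → ℝ :=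
    fun s => alg.meanReward (perturbation θ v B a b s) u with hp
  have hpm : ∀ s t, Measurable (p s t) := fun s t => alg.measurable_meanReward _ u t
  have hw : ∀ t, Measurable fun h => alg.act t u h ⬝ᵥ v i := fun t =>
    alg.measurable_meanReward (v i) u t
  set K := matNorm A (v i) + |c ⬝ᵥ v i| with hK
  have hwK : ∀ t h, |alg.act t u h ⬝ᵥ v i| ≤ K := fun t h =>
    abs_dotProduct_le hA (alg.act_mem _ _ _) _
  have hdiff : ∀ s t h, p (flipSign i s) t h - p s t h =
      -(2 * B * b * ((s i : ℤ) : ℝ) * (alg.act t u h ⬝ᵥ v i)) := fun s t h =>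
    dotProduct_perturbation_flip θ v B a b s i _
  have hdiff2 : ∀ s t h, (p (flipSign i s) t h - p s t h) ^ 2 =
      4 * B ^ 2 * b ^ 2 * (alg.act t u h ⬝ᵥ v i) ^ 2 := fun s t h => by
    rw [hdiff]
    linear_combination 4 * B ^ 2 * b ^ 2 * (alg.act t u h ⬝ᵥ v i) ^ 2 * sq_units_cast (s i)
  have hσ2 : σ ^ 2 ≠ 0 := pow_ne_zero 2 hσ
  have hσ' : (0 : ℝ) < (σ : ℝ) ^ 2 := by positivity
  refine sum_error_lower_bound (flipSign i) _
    (fun s t => integral_nonneg fun h => sq_nonneg _) (sq_nonneg b) (by positivity) T ?_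
  intro s t _
  have hC : ∀ t h, |p (flipSign i s) t h - p s t h| ≤ |2 * B * b * ((s i : ℤ) : ℝ)| * K := by
    intro t h
    rw [hdiff, abs_neg, abs_mul]
    exact mul_le_mul_of_nonneg_left (hwK t h) (abs_nonneg _)
  have h2 := two_point_historyLaw hσ2 (hpm s) (hpm (flipSign i s)) hC t (hw t) (hwK t)
    (b * ((s i : ℤ) : ℝ))
  have hflip : ∀ h : Fin t → ℝ, (alg.act t u h ⬝ᵥ v i - b * ((flipSign i s i : ℤ) : ℝ)) ^ 2 =
      (alg.act t u h ⬝ᵥ v i + b * ((s i : ℤ) : ℝ)) ^ 2 := fun h => by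
    rw [flipSign_same]
    push_cast
    ring
  simp only [hflip]
  refine le_trans ?_ h2
  rw [mul_pow, sq_units_cast, mul_one, Finset.mul_sum]
  refine mul_le_mul_of_nonneg_left (sub_le_sub_left (Finset.sum_le_sum fun j _ => ?_) _)
    (by positivity)
  have := isProbabilityMeasure_historyLaw (v := σ ^ 2) (hpm s) j
  simp only [hdiff2]
  rw [integral_const_mul]
  have hbd : ∀ x : ℝ, ∀ h, |(alg.act j u h ⬝ᵥ v i - x) ^ 2| ≤ (K + |x|) ^ 2 := fun x h => by
    rw [abs_pow]
    exact pow_le_pow_left₀ (abs_nonneg _) ((abs_sub _ _).trans (by linarith [hwK j h])) 2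
  have hi : ∀ x : ℝ, Integrable (fun h => (alg.act j u h ⬝ᵥ v i - x) ^ 2)
      (historyLaw (σ ^ 2) (p s) j) := fun x =>
    integrable_of_abs_le (((hw j).sub_const x).pow_const 2) (hbd x)
  have hi0 : Integrable (fun h => (alg.act j u h ⬝ᵥ v i) ^ 2) (historyLaw (σ ^ 2) (p s) j) := by
    simpa using hi 0
  -- Information is paid for by error: `X ^ 2 ≤ 2 * b ^ 2 + 2 * (X - b * s i) ^ 2`, with gap `(X - 2
  -- * b * s i) ^ 2`.
  have h3 := integral_mono hi0 ((integrable_const (2 * b ^ 2)).add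
    ((hi (b * ((s i : ℤ) : ℝ))).const_mul 2)) fun h => by
      have h4 := sq_units_cast (s i)
      have h5 : b ^ 2 * ((s i : ℤ) : ℝ) ^ 2 = b ^ 2 := by rw [h4, mul_one]
      simp only [Pi.add_apply]
      nlinarith [sq_nonneg (alg.act j u h ⬝ᵥ v i - 2 * (b * ((s i : ℤ) : ℝ)))]
  rw [integral_add' (integrable_const _) ((hi _).const_mul 2),
    integral_const_mul (2 : ℝ) fun h => (alg.act j u h ⬝ᵥ v i - b * ((s i : ℤ) : ℝ)) ^ 2] at h3
  simp only [integral_const, probReal_univ, one_smul] at h3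
  have h6 := mul_le_mul_of_nonneg_left h3 (by positivity : 0 ≤ 2 * B ^ 2 * b ^ 2 / (σ : ℝ) ^ 2)
  refine le_trans (le_of_eq ?_) h6
  push_cast
  field_simp
  ring

theorem Algorithm.sum_perturbation_regret (alg : Algorithm A c U) (hA : A.PosDef) {σ : ℝ≥0}
    (hσ : σ ≠ 0) (hd : d ≠ 0) (θ : Fin (d + 2) → ℝ) (v : Fin d → Fin (d + 2) → ℝ) {B a b D : ℝ}
    (hB : 0 < B)
    (hv : ∀ s : Fin d → ℤˣ, ∀ x ∈ ellipsoid A c,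
      B / 2 * ∑ i, (x ⬝ᵥ v i - b * ((s i : ℤ) : ℝ)) ^ 2 ≤
        optimalReward A c (perturbation θ v B a b s) - x ⬝ᵥ perturbation θ v B a b s)
    (T : ℕ) (hD0 : 0 ≤ D) (hD1 : D ≤ 1 / 2) (hDσ : 64 * T * B ^ 2 * D ^ 2 ≤ σ ^ 2 * d ^ 2)
    (hb : d * b ^ 2 = D * (2 - D)) (u : U) :
    Fintype.card (Fin d → ℤˣ) * (T * B * D / 2) ≤
      ∑ s : Fin d → ℤˣ, ∑ t ∈ Finset.range T,
        ∫ h, (optimalReward A c (perturbation θ v B a b s) -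
            alg.meanReward (perturbation θ v B a b s) u t h)
          ∂(historyLaw (σ ^ 2) (alg.meanReward (perturbation θ v B a b s) u) t) := by
  set M : (Fin d → ℤˣ) → ℕ → Fin d → ℝ := fun s t i =>
    ∫ h, (alg.act t u h ⬝ᵥ v i - b * ((s i : ℤ) : ℝ)) ^ 2
      ∂(historyLaw (σ ^ 2) (alg.meanReward (perturbation θ v B a b s) u) t) with hM
  set y : ℝ := 2 * (2 * B ^ 2 * b ^ 2 / σ ^ 2) * T * b ^ 2 with hy
  have hd' : (0 : ℝ) < d := by exact_mod_cast Nat.pos_of_ne_zero hd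
  have hσ' : (0 : ℝ) < σ := by positivity
  have hy0 : 0 ≤ y := by positivity
  have hy1 : 16 * y ≤ (2 - D) ^ 2 := by
    have h1 : 16 * y * (σ ^ 2 * d ^ 2) = 64 * T * B ^ 2 * (d * b ^ 2) ^ 2 := by
      rw [hy]
      field_simp
      ring
    have h2 : 16 * y * (σ ^ 2 * d ^ 2) ≤ (2 - D) ^ 2 * (σ ^ 2 * d ^ 2) := by
      rw [h1, hb]
      nlinarith [mul_le_mul_of_nonneg_left hDσ (sq_nonneg (2 - D))]
    exact le_of_mul_le_mul_right h2 (by positivity)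
  -- This trades the factor `2 - D` in `d * b ^ 2 = D * (2 - D)` for the entropy loss `(1 + y) / (1
  -- - y)`. The constant `64` in `hDσ` gives `y ≤ (2 - D) ^ 2 / 16`, small enough for `D ≤ 1 / 2`.
  have hy2 : 1 + y ≤ (2 - D) * (1 - y) := by
    have h3 : (3 - D) * (16 * y) ≤ (3 - D) * (2 - D) ^ 2 :=
      mul_le_mul_of_nonneg_left hy1 (by linarith)
    nlinarith [mul_nonneg hD0 (sub_nonneg.2 hD1), mul_nonneg hD0 (mul_nonneg hD0 hD0)]
  have hround : ∀ s t, B / 2 * ∑ i, M s t i ≤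
      ∫ h, (optimalReward A c (perturbation θ v B a b s) -
          alg.meanReward (perturbation θ v B a b s) u t h)
        ∂(historyLaw (σ ^ 2) (alg.meanReward (perturbation θ v B a b s) u) t) := by
    intro s t
    have hpm := fun t => alg.measurable_meanReward (perturbation θ v B a b s) u t
    have := isProbabilityMeasure_historyLaw (v := σ ^ 2) hpm t
    have hi : ∀ i, Integrable (fun h => (alg.act t u h ⬝ᵥ v i - b * ((s i : ℤ) : ℝ)) ^ 2)
        (historyLaw (σ ^ 2) (alg.meanReward (perturbation θ v B a b s) u) t) := fun i =>
      integrable_of_abs_le (((alg.measurable_meanReward (v i) u t).sub_const _).pow_const 2)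
        (C := (matNorm A (v i) + |c ⬝ᵥ v i| + |b * ((s i : ℤ) : ℝ)|) ^ 2) fun h => by
          rw [abs_pow]
          exact pow_le_pow_left₀ (abs_nonneg _) ((abs_sub _ _).trans
            (add_le_add_left (abs_dotProduct_le hA (alg.act_mem t u h) (v i)) _)) 2
    rw [hM, ← integral_finsetSum _ fun i _ => hi i, ← integral_const_mul]
    refine integral_mono ((integrable_finsetSum _ fun i _ => hi i).const_mul _)
      ((integrable_const _).sub (integrable_of_abs_le (hpm t)
        fun h => abs_dotProduct_le hA (alg.act_mem t u h) _)) fun h => hv s _ (alg.act_mem t u h)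
  have hcoord : ∀ i, Fintype.card (Fin d → ℤˣ) * T * b ^ 2 * (1 - y) ≤
      (1 + y) * ∑ s, ∑ t ∈ Finset.range T, M s t i := fun i =>
    alg.sum_perturbation_error hA hσ θ v B a b u T i
  have hsum := Finset.sum_le_sum fun i (_ : i ∈ Finset.univ) => hcoord i
  rw [Finset.sum_const, Finset.card_univ, Fintype.card_fin, nsmul_eq_mul, ← Finset.mul_sum] at hsum
  have hswap : ∑ i, ∑ s, ∑ t ∈ Finset.range T, M s t i =
      ∑ s, ∑ t ∈ Finset.range T, ∑ i, M s t i := by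
    rw [Finset.sum_comm]
    exact Finset.sum_congr rfl fun s _ => Finset.sum_comm
  rw [hswap] at hsum
  refine le_trans ?_ (Finset.sum_le_sum fun s _ => Finset.sum_le_sum fun t _ => hround s t)
  simp only [← Finset.mul_sum]
  set X := ∑ s, ∑ t ∈ Finset.range T, ∑ i, M s t i
  set N : ℝ := (Fintype.card (Fin d → ℤˣ) : ℝ)
  have hN : 0 ≤ N := Nat.cast_nonneg _
  have h7 : (1 + y) * (N * T * D) ≤ (1 + y) * X := by
    refine le_trans ?_ hsum
    have h8 : d * (N * T * b ^ 2 * (1 - y)) = N * T * D * ((2 - D) * (1 - y)) := by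
      linear_combination N * T * (1 - y) * hb
    rw [h8, mul_comm (1 + y)]
    exact mul_le_mul_of_nonneg_left hy2 (by positivity)
  have h9 := le_of_mul_le_mul_left h7 (by linarith)
  nlinarith [mul_le_mul_of_nonneg_left h9 hB.le]

/-- The bound holds on average over the sign vectors for each seed, hence after integrating the seed
out; some sign vector reaches the average. Choosing it last makes `θ'` independent of the seed. -/
theorem Algorithm.exists_regret_lower_bound (alg : Algorithm A c U) (hA : A.PosDef) {σ : ℝ≥0}
    (hσ : σ ≠ 0) (hd : d ≠ 0) {B : ℝ} (hB : 0 < B) {θ : Fin (d + 2) → ℝ} (hθ : matNorm A θ = B)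
    (T : ℕ) {D : ℝ} (hD0 : 0 ≤ D) (hD1 : D ≤ 1 / 2)
    (hDσ : 64 * T * B ^ 2 * D ^ 2 ≤ σ ^ 2 * d ^ 2) :
    ∃ θ', matNorm A θ' = B ∧ matNorm A (θ - θ') ^ 2 = 2 * B ^ 2 * D ∧
      T * B * D / 2 ≤ alg.regret (gaussianNoise σ) T θ' := by
  obtain ⟨v, hv⟩ := exists_perturbation_directions hA c hB hθ
  have hd' : (0 : ℝ) < d := by exact_mod_cast Nat.pos_of_ne_zero hd
  -- Chosen so that `(1 - D) ^ 2 + d * b ^ 2 = 1`, which keeps the perturbed parameter on the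
  -- sphere.
  set b := √(D * (2 - D) / d) with hb
  have hb2 : d * b ^ 2 = D * (2 - D) := by
    rw [hb, Real.sq_sqrt (div_nonneg (mul_nonneg hD0 (by linarith)) hd'.le), mul_div_cancel₀ _ hd'.ne']
  have hk : ∀ s : Fin d → ℤˣ, (1 - D) ^ 2 + ∑ i, (b * ((s i : ℤ) : ℝ)) ^ 2 = 1 := by
    intro s
    simp only [mul_pow, sq_units_cast, mul_one, Finset.sum_const, Finset.card_univ,
      Fintype.card_fin, nsmul_eq_mul, hb2]
    ring
  have hpert := fun s : Fin d → ℤˣ => hv (1 - D) (fun i => b * ((s i : ℤ) : ℝ)) (hk s)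
  have hreg := fun s : Fin d → ℤˣ =>
    alg.regret_eq (perturbation θ v B (1 - D) b s) hA σ T
  have hsum : ∑ _s : Fin d → ℤˣ, T * B * D / 2 ≤ ∑ s : Fin d → ℤˣ,
      alg.regret (gaussianNoise σ) T (perturbation θ v B (1 - D) b s) := by
    simp only [fun s => (hreg s).2]
    rw [← integral_finsetSum _ fun s _ => (hreg s).1, Finset.sum_const, Finset.card_univ,
      nsmul_eq_mul]
    have h1 := integral_mono (μ := alg.seedLaw)
      (integrable_const (Fintype.card (Fin d → ℤˣ) * (T * B * D / 2)))
      (integrable_finsetSum _ fun s _ => (hreg s).1)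
      fun u => alg.sum_perturbation_regret hA hσ hd θ v hB
        (fun s x hx => (hpert s).2.2 x hx) T hD0 hD1 hDσ hb2 u
    simpa only [integral_const, probReal_univ, one_smul] using h1
  obtain ⟨s, -, hs⟩ := Finset.exists_le_of_sum_le Finset.univ_nonempty hsum
  refine ⟨perturbation θ v B (1 - D) b s, (hpert s).1, (hpert s).2.1.trans ?_, hs⟩
  ring

end LowerBound

end EllipsoidBandit

theorem theorem1 {d : ℕ} (A : Matrix (Fin (d + 2)) (Fin (d + 2)) ℝ) (hA : A.PosDef)
    (c : Fin (d + 2) → ℝ) (σ : ℝ≥0)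
    {U : Type*} [MeasurableSpace U] (alg : Algorithm A c U)
    (B : ℝ) (hB : 0 < B) (T : ℕ) (hT : 1 ≤ T)
    (θ : Fin (d + 2) → ℝ) (hθ : θ ∈ parameterSphere A B) :
    ∃ θ' ∈ parameterSphere A B,
      matNorm A (θ - θ') ^ 2 ≤ min ((σ : ℝ) * d * B / Real.sqrt T) (4 * B ^ 2) ∧
      min ((σ : ℝ) * d * Real.sqrt T / 16) (B * T / 4) ≤
        alg.regret (gaussianNoise σ) T θ' := by
  have hT0 : (0 : ℝ) < T := by exact_mod_cast hT
  have hs0 : 0 < √(T : ℝ) := Real.sqrt_pos.2 hT0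
  have hs2 : √(T : ℝ) ^ 2 = T := Real.sq_sqrt hT0.le
  by_cases hdσ : d = 0 ∨ σ = 0
  -- In the degenerate case the required regret is at most `0`, so `θ` itself serves.
  · have h0 : (σ : ℝ) * d = 0 := by
      rcases hdσ with h | h <;> simp [h]
    refine ⟨θ, hθ, ?_, ?_⟩
    · rw [sub_self, h0]
      simp only [matNorm, zero_dotProduct, Real.sqrt_zero, zero_mul, zero_div]
      rw [zero_pow two_ne_zero]
      exact le_min le_rfl (by positivity)
    · refine (min_le_left _ _).trans ?_
      rw [h0, zero_mul, zero_div]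
      exact alg.regret_nonneg θ hA _ T
  · obtain ⟨hd, hσ⟩ := not_or.1 hdσ
    -- The largest `D` allowed by both constraints; the two branches turn `T * B * D / 2` into the
    -- two terms of the claimed minimum.
    set D : ℝ := min (σ * d / (8 * √T * B)) (1 / 2) with hD
    have hD0 : 0 ≤ D := le_min (by positivity) (by norm_num)
    have hDl : D * (8 * √T * B) ≤ σ * d :=
      (le_div_iff₀ (by positivity)).1 (min_le_left _ _)
    have hDσ : 64 * T * B ^ 2 * D ^ 2 ≤ (σ : ℝ) ^ 2 * d ^ 2 := by
      have h1 := pow_le_pow_left₀ (by positivity) hDl 2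
      rw [← hs2]
      calc _ = (D * (8 * √T * B)) ^ 2 := by ring
        _ ≤ _ := h1
        _ = _ := by ring
    obtain ⟨θ', h1, h2, h3⟩ :=
      alg.exists_regret_lower_bound hA hσ hd hB hθ T hD0 (min_le_right _ _) hDσ
    refine ⟨θ', h1, ?_, le_trans ?_ h3⟩
    · rw [h2]
      refine le_min ?_ ?_
      · rw [le_div_iff₀ hs0]
        nlinarith [mul_le_mul_of_nonneg_left hDl hB.le, mul_nonneg (mul_nonneg hB.le hB.le)
          (mul_nonneg hD0 hs0.le)]
      · nlinarith [mul_le_mul_of_nonneg_left (min_le_right _ _ : D ≤ 1 / 2) (sq_nonneg B),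
          sq_nonneg B]
    · rcases min_choice ((σ : ℝ) * d / (8 * √T * B)) (1 / 2) with h | h
      · refine (min_le_left _ _).trans (le_of_eq ?_)
        rw [hD, h]
        field_simp
        rw [hs2]
        ring
      · refine (min_le_right _ _).trans (le_of_eq ?_)
        rw [hD, h]
        ring
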